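/- Let $\omega$ be a non-principal ultrafilter on $\mathbb{N}$ and let $(n_k)_{k}$ be a sequence of positive integers with $\lim_k n_k=\infty$. For $p,q\in S_{N}$ let $d_{Hamm}(p,q)=\frac1N|\{a:p(a)\neq q(a)\}|$, and let $$\Pi_{k\to\omega}S_{n_k}=\Big(\prod_k S_{n_k}\Big)\Big/\Big\{(p_k)_k:\lim_{k\to\omega}d_{Hamm}(p_k,\mathrm{Id})=0\Big\}$$ be the universal sofic group; write $\Pi_{k\to\omega}p_k$ for the class of $(p_k)_k$. For $p\in S_N$ let $cyc_i(p)$ be $i$ times the number of cycles of length $i$ of $p$ (fixed points being the cycles of length $1$), $m(p)$ the size of the support of $p$, and $n(p)$ the number of nontrivial cycles of $p$. For $p=\Pi_{k\to\omega}p_k\in\Pi_{k\to\omega}S_{n_k}$ put $$cyc_i(p)=\lim_{k\to\omega}\frac{cyc_i(p_k)}{n_k}\ (i\geq1),\quad m(p)=\lim_{k\to\omega}\frac{m(p_k)}{n_k},\quad n(p)=\lim_{k\to\omega}\frac{n(p_k)}{n_k},\quad cyc_\infty(p)=1-\sum_{i\geq1}cyc_i(p);$$ these do not depend on the choice of the representatives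 $p_k$. Let $cyc(\{1,\infty\})$ be the set of those $p\in\Pi_{k\to\omega}S_{n_k}$ with $cyc_i(p)=0$ for all $2\leq i<\infty$, and let $Cl(q)$ denote the conjugacy class of $q$ in $\Pi_{k\to\omega}S_{n_k}$. **Theorem.** Let $p\in\Pi_{k\to\omega}S_{n_k}$ and let $q_1,q_2\in cyc(\{1,\infty\})$ with $cyc_\infty(q_1)\geq cyc_\infty(q_2)>0$. Then $p\in Cl(q_1)Cl(q_2)$ if and only if both of the following hold: 1. $m(p)+n(p)\leq cyc_\infty(q_1)+cyc_\infty(q_2)$; 2. $m(p)-n(p)\geq cyc_\infty(q_1)-cyc_\infty(q_2)$. -/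

import Mathlib

open Filter Topology
open scoped Pointwise

noncomputable section

namespace SoficGroup

/-! ### Finite symmetric groups -/

/-- The symmetric group `S_N`. -/
abbrev S (N : ℕ) : Type := Equiv.Perm (Fin N)

/-- The normalized Hamming distance on `S_N`. -/
def dHamm {N : ℕ} (p q : S N) : ℝ := (hammingDist (⇑p) (⇑q) : ℝ) / N

/-- `cyc_i(p)`: `i` times the number of cycles of length `i` of `p`, where the fixed points are
the cycles of length `1` (`p.partition` is the partition of `N` given by all cycle lengths). -/
def permCyc (i : ℕ) {N : ℕ} (p : S N) : ℕ := i * p.partition.parts.count i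

/-- `m(p)`: the size of the support of `p`. -/
def permM {N : ℕ} (p : S N) : ℕ := p.support.card

/-- `n(p)`: the number of nontrivial cycles of `p`. -/
def permN {N : ℕ} (p : S N) : ℕ := p.cycleFactorsFinset.card

/-! ### Lipschitz estimates, which make the limits below independent of representatives -/

/-- `f` is a Lipschitz function for the (unnormalized) Hamming distances, uniformly in `N`. -/
def UnifLip (f : ∀ {N : ℕ}, S N → ℕ) : Prop :=
  ∃ C : ℕ, ∀ (N : ℕ) (p q : S N), f p ≤ f q + C * hammingDist (⇑p) (⇑q)

theorem card_cycles_sdiff_le {N : ℕ} (p q : S N) :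
    (p.cycleFactorsFinset \ q.cycleFactorsFinset).card ≤ hammingDist (⇑p) (⇑q) := by
  have key : ∀ c ∈ p.cycleFactorsFinset \ q.cycleFactorsFinset,
      ∃ a, a ∈ c.support ∧ p a ≠ q a := by
    intro c hc
    rw [Finset.mem_sdiff] at hc
    by_contra! h
    apply hc.2
    have hp := Equiv.Perm.mem_cycleFactorsFinset_iff.mp hc.1
    exact Equiv.Perm.mem_cycleFactorsFinset_iff.mpr
      ⟨hp.1, fun a ha => (hp.2 a ha).trans (h a ha)⟩
  rcases isEmpty_or_nonempty (Fin N) with hN | hN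
  · have h0 : p.cycleFactorsFinset \ q.cycleFactorsFinset = ∅ :=
      Finset.eq_empty_of_forall_notMem fun c hc => isEmptyElim (key c hc).choose
    simp [h0]
  choose! g hg using key
  unfold hammingDist
  apply Finset.card_le_card_of_injOn g
  · intro c hc
    simpa using (hg c hc).2
  · intro c hc d hd hcd
    have hc' := Finset.mem_coe.mp hc
    have hd' := Finset.mem_coe.mp hd
    by_contra hne
    have hdis := Equiv.Perm.cycleFactorsFinset_pairwise_disjoint p
      (Finset.mem_sdiff.mp hc').1 (Finset.mem_sdiff.mp hd').1 hne
    have h1 := (hg c hc').1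
    have h2 := (hg d hd').1
    rw [← hcd] at h2
    exact Finset.disjoint_left.mp hdis.disjoint_support h1 h2

theorem unifLip_permM : UnifLip @permM := by
  refine ⟨1, fun N p q => ?_⟩
  rw [one_mul]
  unfold permM hammingDist
  refine le_trans (Finset.card_le_card ?_) (Finset.card_union_le _ _)
  intro a ha
  simp only [Finset.mem_union, Equiv.Perm.mem_support, Finset.mem_filter, Finset.mem_univ,
    true_and] at ha ⊢
  by_contra! h
  exact ha (h.2.trans h.1)

theorem unifLip_permN : UnifLip @permN := by
  refine ⟨1, fun N p q => ?_⟩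
  have h := card_cycles_sdiff_le p q
  have h2 := Finset.card_le_card_sdiff_add_card
    (s := p.cycleFactorsFinset) (t := q.cycleFactorsFinset)
  unfold permN
  omega

theorem count_parts {N : ℕ} (p : S N) (i : ℕ) :
    p.partition.parts.count i =
      (p.cycleFactorsFinset.filter (fun c => c.support.card = i)).card
        + if i = 1 then N - p.support.card else 0 := by
  rw [Equiv.Perm.parts_partition, Multiset.count_add, Multiset.count_replicate,
    Equiv.Perm.cycleType_def, Multiset.count_map, ← Finset.filter_val, Finset.card_val,
    Fintype.card_fin]
  simp only [eq_comm, Function.comp_apply]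

theorem unifLip_permCyc (i : ℕ) : UnifLip (@permCyc i) := by
  refine ⟨2 * i, fun N p q => ?_⟩
  obtain ⟨h1, h2⟩ :
      (p.cycleFactorsFinset.filter (fun c => c.support.card = i)).card ≤
        (q.cycleFactorsFinset.filter (fun c => c.support.card = i)).card
          + hammingDist (⇑p) (⇑q) ∧
      q.support.card ≤ p.support.card + hammingDist (⇑p) (⇑q) := by
    constructor
    · have h := card_cycles_sdiff_le p q
      have h2 := Finset.card_le_card_sdiff_add_card
        (s := p.cycleFactorsFinset.filter (fun c => c.support.card = i))
        (t := q.cycleFactorsFinset.filter (fun c => c.support.card = i))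
      have h3 : (p.cycleFactorsFinset.filter (fun c => c.support.card = i)) \
          (q.cycleFactorsFinset.filter (fun c => c.support.card = i)) ⊆
            p.cycleFactorsFinset \ q.cycleFactorsFinset := by
        intro c hc
        simp only [Finset.mem_sdiff, Finset.mem_filter] at hc ⊢
        exact ⟨hc.1.1, fun h => hc.2 ⟨h, hc.1.2⟩⟩
      have h4 := Finset.card_le_card h3
      omega
    · have h : q.support ⊆ p.support ∪ Finset.univ.filter (fun a => p a ≠ q a) := by
        intro a ha
        simp only [Finset.mem_union, Equiv.Perm.mem_support, Finset.mem_filter,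
          Finset.mem_univ, true_and] at ha ⊢
        by_contra! h
        exact ha (h.2.symm.trans h.1)
      exact le_trans (Finset.card_le_card h) (Finset.card_union_le _ _)
  have h5 : p.partition.parts.count i ≤
      q.partition.parts.count i + 2 * hammingDist (⇑p) (⇑q) := by
    rw [count_parts, count_parts]
    split_ifs <;> omega
  unfold permCyc
  calc i * p.partition.parts.count i
      ≤ i * (q.partition.parts.count i + 2 * hammingDist (⇑p) (⇑q)) :=
        Nat.mul_le_mul_left _ h5
    _ = _ := by ring

/-! ### The universal sofic group -/

theorem dHamm_nonneg {N : ℕ} (p q : S N) : 0 ≤ dHamm p q := by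
  unfold dHamm; positivity

theorem dHamm_triangle {N : ℕ} (p q r : S N) : dHamm p r ≤ dHamm p q + dHamm q r := by
  unfold dHamm
  rw [← add_div]
  gcongr
  exact_mod_cast hammingDist_triangle _ _ _

theorem dHamm_mul_left {N : ℕ} (g p q : S N) : dHamm (g * p) (g * q) = dHamm p q := by
  unfold dHamm hammingDist
  simp

theorem dHamm_mul_right {N : ℕ} (p q g : S N) : dHamm (p * g) (q * g) = dHamm p q := by
  unfold dHamm
  congr 2
  unfold hammingDist
  refine Finset.card_equiv g fun i => ?_
  rw [Finset.mem_filter_univ, Finset.mem_filter_univ]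
  rfl

theorem dHamm_comm {N : ℕ} (p q : S N) : dHamm p q = dHamm q p := by
  unfold dHamm
  rw [hammingDist_comm]

/-- The subgroup `𝒩_ω` of `∏ₖ S_{n_k}`: the sequences whose Hamming distance to the identity
tends to `0` along `ω`. -/
def nullSubgroup (n : ℕ → ℕ) (ω : Ultrafilter ℕ) : Subgroup (∀ k, S (n k)) where
  carrier := {p | Tendsto (fun k => dHamm (p k) 1) ω (𝓝 0)}
  one_mem' := by simp [dHamm]
  mul_mem' := by
    intro p q hp hq
    have h := Tendsto.add hp hq
    rw [add_zero] at h
    refine squeeze_zero (fun k => dHamm_nonneg _ _) (fun k => ?_) h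
    have h1 := dHamm_triangle ((p * q) k) (q k) 1
    have h2 : dHamm ((p * q) k) (q k) = dHamm (p k) 1 := by
      have := dHamm_mul_right (p k) 1 (q k)
      rwa [one_mul] at this
    exact h2 ▸ h1
  inv_mem' := by
    intro p hp
    refine Tendsto.congr (fun k => ?_) hp
    have := dHamm_mul_left (p k)⁻¹ (p k) 1
    rw [inv_mul_cancel, mul_one] at this
    rw [← this, dHamm_comm]
    rfl

instance nullSubgroup_normal (n : ℕ → ℕ) (ω : Ultrafilter ℕ) : (nullSubgroup n ω).Normal where
  conj_mem := by
    intro p hp g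
    refine Tendsto.congr (fun k => ?_) hp
    have h1 := dHamm_mul_right (g k * p k) (g k) (g k)⁻¹
    have h2 := dHamm_mul_left (g k) (p k) 1
    rw [mul_inv_cancel] at h1
    rw [mul_one] at h2
    rw [← h2, ← h1]
    rfl

/-- The universal sofic group `∏_{k → ω} S_{n_k}`. -/
abbrev USofic (n : ℕ → ℕ) (ω : Ultrafilter ℕ) : Type :=
  (∀ k, S (n k)) ⧸ nullSubgroup n ω

variable {n : ℕ → ℕ} {ω : Ultrafilter ℕ}

theorem limUnder_congr_of_mem (f : ∀ {N : ℕ}, S N → ℕ) (hf : UnifLip @f)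
    (p q : ∀ k, S (n k)) (h : p⁻¹ * q ∈ nullSubgroup n ω) :
    limUnder (ω : Filter ℕ) (fun k => (f (p k) : ℝ) / n k) =
      limUnder (ω : Filter ℕ) (fun k => (f (q k) : ℝ) / n k) := by
  obtain ⟨C, hC⟩ := hf
  have hd : Tendsto (fun k => (C : ℝ) * dHamm (p k) (q k)) ω (𝓝 0) := by
    have h' : Tendsto (fun k => dHamm ((p⁻¹ * q) k) 1) ω (𝓝 0) := h
    have := h'.const_mul (C : ℝ)
    rw [mul_zero] at this
    refine this.congr fun k => ?_
    have h1 := dHamm_mul_left (p k) ((p k)⁻¹ * q k) 1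
    rw [mul_inv_cancel_left, mul_one] at h1
    rw [dHamm_comm (p k), h1]
    rfl
  have hle : ∀ k, |(f (p k) : ℝ) / n k - (f (q k) : ℝ) / n k| ≤ C * dHamm (p k) (q k) := by
    intro k
    have h1 : (f (p k) : ℝ) ≤ f (q k) + C * hammingDist (⇑(p k)) (⇑(q k)) := by
      exact_mod_cast hC _ (p k) (q k)
    have h2 : (f (q k) : ℝ) ≤ f (p k) + C * hammingDist (⇑(p k)) (⇑(q k)) := by
      rw [hammingDist_comm]
      exact_mod_cast hC _ (q k) (p k)
    have h3 : |(f (p k) : ℝ) - f (q k)| ≤ C * hammingDist (⇑(p k)) (⇑(q k)) := by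
      rw [abs_le]; constructor <;> linarith
    unfold dHamm
    rw [← sub_div, abs_div, Nat.abs_cast, ← mul_div_assoc]
    gcongr
  have hsub : Tendsto (fun k => (f (p k) : ℝ) / n k - (f (q k) : ℝ) / n k) ω (𝓝 0) :=
    squeeze_zero_norm hle hd
  have hiff : ∀ x, Tendsto (fun k => (f (p k) : ℝ) / n k) ω (𝓝 x) ↔
      Tendsto (fun k => (f (q k) : ℝ) / n k) ω (𝓝 x) := by
    intro x
    constructor
    · intro hx
      simpa using hx.sub hsub
    · intro hx
      simpa using hsub.add hx
  unfold limUnder lim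
  exact congrArg _ (funext fun x => propext (hiff x))

/-- For a uniformly Lipschitz `f`, the function `∏_{k → ω} pₖ ↦ lim_{k → ω} f(pₖ) / n_k` on the
universal sofic group. -/
def ultraLim (f : ∀ {N : ℕ}, S N → ℕ) (hf : UnifLip @f) : USofic n ω → ℝ :=
  Quotient.lift (fun p : ∀ k, S (n k) => limUnder (ω : Filter ℕ) fun k => (f (p k) : ℝ) / n k)
    fun p q h => limUnder_congr_of_mem @f hf p q (QuotientGroup.leftRel_apply.mp h)

/-- If `0 ≤ f ≤ N` on `S_N`, then the limit defining `ultraLim` exists. -/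
theorem tendsto_ultraLim (f : ∀ {N : ℕ}, S N → ℕ) (hf : UnifLip @f)
    (hb : ∀ (N : ℕ) (p : S N), f p ≤ N) (p : ∀ k, S (n k)) :
    Tendsto (fun k => (f (p k) : ℝ) / n k) ω
      (𝓝 (ultraLim @f hf (QuotientGroup.mk p : USofic n ω))) := by
  change Tendsto _ _ (𝓝 (limUnder (ω : Filter ℕ) fun k => (f (p k) : ℝ) / n k))
  apply tendsto_nhds_limUnder
  have hmem : (ω.map fun k => (f (p k) : ℝ) / n k : Filter ℝ) ≤ 𝓟 (Set.Icc 0 1) := by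
    rw [le_principal_iff]
    refine Filter.mem_map.mpr (Filter.univ_mem' fun k => ⟨by positivity, ?_⟩)
    exact div_le_one_of_le₀ (by exact_mod_cast hb _ (p k)) (by positivity)
  obtain ⟨x, -, hx⟩ := isCompact_iff_ultrafilter_le_nhds.mp (isCompact_Icc (a := (0 : ℝ)) (b := 1))
    (ω.map fun k => (f (p k) : ℝ) / n k) hmem
  exact ⟨x, hx⟩

/-- `cyc_i(p) = lim_{k → ω} cyc_i(pₖ) / n_k`. -/
def cyc (i : ℕ) (p : USofic n ω) : ℝ := ultraLim (@permCyc i) (unifLip_permCyc i) p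

/-- `m(p) = lim_{k → ω} m(pₖ) / n_k`. -/
def m (p : USofic n ω) : ℝ := ultraLim @permM unifLip_permM p

/-- `n(p) = lim_{k → ω} n(pₖ) / n_k`. -/
def numCyc (p : USofic n ω) : ℝ := ultraLim @permN unifLip_permN p

/-- `cyc_∞(p) = 1 - ∑_{i ≥ 1} cyc_i(p)`. -/
def cycInf (p : USofic n ω) : ℝ := 1 - ∑' i : ℕ, cyc (i + 1) p

/-- `cyc({1, ∞})`: the elements with `cyc_i(p) = 0` for all `2 ≤ i < ∞`. -/
def cycOneInf (n : ℕ → ℕ) (ω : Ultrafilter ℕ) : Set (USofic n ω) :=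
  {p | ∀ i : ℕ, 2 ≤ i → cyc i p = 0}

theorem sum_permCyc_le {N : ℕ} (p : S N) (s : Finset ℕ) : ∑ i ∈ s, permCyc i p ≤ N := by
  have h : ∑ i ∈ s ∪ p.partition.parts.toFinset, permCyc i p = N := by
    rw [← Finset.sum_subset Finset.subset_union_right]
    · have h1 := Finset.sum_multiset_count p.partition.parts
      have h2 : p.partition.parts.sum = N := by
        simpa using p.partition.parts_sum
      refine Eq.trans ?_ (h1.symm.trans h2)
      exact Finset.sum_congr rfl fun i _ => by simp [permCyc, mul_comm]
    · intro i _ hi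
      rw [Multiset.mem_toFinset] at hi
      simp [permCyc, Multiset.count_eq_zero_of_notMem hi]
  exact (Finset.sum_le_sum_of_subset Finset.subset_union_left).trans h.le

theorem permCyc_le (i : ℕ) {N : ℕ} (p : S N) : permCyc i p ≤ N := by
  simpa using sum_permCyc_le p {i}

/-- The series in the definition of `cycInf` converges. -/
theorem summable_cyc (p : USofic n ω) : Summable fun i : ℕ => cyc (i + 1) p := by
  obtain ⟨p, rfl⟩ := QuotientGroup.mk_surjective p
  have ht : ∀ i, Tendsto (fun k => (permCyc i (p k) : ℝ) / n k) ω
      (𝓝 (cyc i (QuotientGroup.mk p : USofic n ω))) := fun i =>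
    tendsto_ultraLim (@permCyc i) (unifLip_permCyc i) (fun N p => permCyc_le i p) p
  refine summable_of_sum_le (c := 1)
    (fun i => ge_of_tendsto' (ht (i + 1)) fun k => by positivity) fun s => ?_
  refine le_of_tendsto' (tendsto_finsetSum s fun i _ => ht (i + 1)) fun k => ?_
  rw [← Finset.sum_div]
  refine div_le_one_of_le₀ ?_ (by positivity)
  have h := sum_permCyc_le (p k) (s.map ⟨Nat.succ, Nat.succ_injective⟩)
  rw [Finset.sum_map] at h
  exact_mod_cast h

end SoficGroup

end

/-! An element of `cycOneInf` is determined up to conjugacy by one number. Since only a negligible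
part of it lies in cycles of bounded length, its number of nontrivial cycles is o(n_k)
(`numCyc_eq_zero`), so joining them into one cycle changes it by Hamming distance tending to 0. Two
cycles of nearly equal length are nearly conjugate (`CycOn.exists_conj_near`), and `cycInf` is the
normalized length m. The question becomes finite: which permutations p are, up to o(N), products of
a cycle of length a and a cycle of length b?

Necessity comes from counting cycles of xy. Those avoiding supp x ∩ supp y are cycles of x or of y,
and those avoiding supp(xy) ∩ supp y are cycles of x. Disjoint cycles meeting a set T number at most
|T|, so inclusion-exclusion on supports gives `permM_add_permN_mul_le` and
`permM_add_permN_mul_le'`. In the limit the cycle counts of the factors vanish.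

For sufficiency, write p = XY with X a cycle on supp p and Y a cycle through one point of each
nontrivial cycle of p (`exists_cycOn_support_mul`). The lengths are then (m(p), n(p)), the case of
equality in both conditions. Rewriting XY as X(r u)·(r u)Y moves the supports A, B without changing
p. A fresh point can be added to both (`FactorsAs.add_fresh`), a point moved from A \ B to B \ A
(`FactorsAs.transfer`), or a point of A \ B and a point of B \ A both made common
(`FactorsAs.cross`). These change (|A|, |B|) by (1, 1), (-1, 1) and (1, 1). The two inequalities
together with b ≤ a say that such moves reach (a, b) up to bounded error. -/

noncomputable section

namespace SoficGroup

open Equiv Equiv.Perm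

variable {N : ℕ}

/-! ### Permutations acting as one cycle on a set -/

/-- `X` fixes the complement of `A` and permutes `A` transitively. If `A` has at least two
elements, then `X` is a cycle with support `A`. -/
def CycOn (X : S N) (A : Finset (Fin N)) : Prop :=
  (∀ x ∉ A, X x = x) ∧ ∀ x ∈ A, ∀ y ∈ A, X.SameCycle x y

theorem CycOn.apply_mem {X : S N} {A : Finset (Fin N)} (h : CycOn X A) {x : Fin N} (hx : x ∈ A) :
    X x ∈ A := by
  by_contra hn
  exact hn (by rwa [X.injective (h.1 _ hn)])

theorem CycOn.inv {X : S N} {A : Finset (Fin N)} (h : CycOn X A) : CycOn X⁻¹ A :=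
  ⟨fun x hx => by rw [Equiv.Perm.inv_eq_iff_eq, h.1 x hx],
    fun x hx y hy => sameCycle_inv.mpr (h.2 x hx y hy)⟩

theorem cycOn_one_singleton (r : Fin N) : CycOn (1 : S N) {r} := by
  refine ⟨fun x _ => rfl, fun x hx y hy => ?_⟩
  rw [Finset.mem_singleton] at hx hy
  rw [hx, hy]

/-- Before it first reaches `r`, the `X`-orbit of `x` is also its `W`-orbit, so changing `X` at `r`
alone does not matter. -/
theorem CycOn.sameCycle_of_agree {X W : S N} {A : Finset (Fin N)} (h : CycOn X A) {r : Fin N}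
    (hr : r ∈ A) (hW : ∀ x ∈ A, x ≠ r → W x = X x) {x : Fin N} (hx : x ∈ A) :
    W.SameCycle x r := by
  obtain ⟨k, hk⟩ := (h.2 x hx r hr).exists_nat_pow_eq
  induction k generalizing x with
  | zero => simp only [pow_zero, Perm.coe_one, id_eq] at hk; rw [hk]
  | succ k ih =>
    by_cases hxr : x = r
    · rw [hxr]
    · rw [pow_succ, Perm.mul_apply, ← hW x hx hxr] at hk
      have hWx : W x ∈ A := hW x hx hxr ▸ h.apply_mem hx
      exact sameCycle_apply_left.mp (ih hWx hk)

/-- Multiplying by a transposition with one point in each of two disjoint cycles joins them: the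
product follows `X` on `A` away from `r` and `Z` on `D` away from `s`, and at `r` it jumps to `Z s`.
-/
theorem CycOn.merge {X Z : S N} {A D : Finset (Fin N)} (hX : CycOn X A) (hZ : CycOn Z D)
    (hd : Disjoint A D) {r s : Fin N} (hr : r ∈ A) (hs : s ∈ D) :
    CycOn (X * Z * swap r s) (A ∪ D) := by
  set W := X * Z * swap r s with hWdef
  have hAD : ∀ {x}, x ∈ A → x ∉ D := fun hx => Finset.disjoint_left.mp hd hx
  have hDA : ∀ {x}, x ∈ D → x ∉ A := fun hx => Finset.disjoint_right.mp hd hx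
  have hWA : ∀ x ∈ A, x ≠ r → W x = X x := by
    intro x hx hxr
    have hxs : x ≠ s := fun h => hAD hx (h ▸ hs)
    rw [hWdef, Perm.mul_apply, Perm.mul_apply, swap_apply_of_ne_of_ne hxr hxs, hZ.1 x (hAD hx)]
  have hWD : ∀ x ∈ D, x ≠ s → W x = Z x := by
    intro x hx hxs
    have hxr : x ≠ r := fun h => hDA hx (h ▸ hr)
    rw [hWdef, Perm.mul_apply, Perm.mul_apply, swap_apply_of_ne_of_ne hxr hxs,
      hX.1 _ (hDA (hZ.apply_mem hx))]
  have hA : ∀ x ∈ A, W.SameCycle x r := fun x hx => hX.sameCycle_of_agree hr hWA hx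
  have hD : ∀ x ∈ D, W.SameCycle x s := fun x hx => hZ.sameCycle_of_agree hs hWD hx
  have hrs : W.SameCycle s r := by
    have h1 : W r = Z s := by
      rw [hWdef, Perm.mul_apply, Perm.mul_apply, swap_apply_left, hX.1 _ (hDA (hZ.apply_mem hs))]
    have h2 := hD _ (hZ.apply_mem hs)
    rw [← h1, sameCycle_apply_left] at h2
    exact h2.symm
  have hall : ∀ x ∈ A ∪ D, W.SameCycle x r := by
    intro x hx
    rcases Finset.mem_union.mp hx with hx | hx
    · exact hA x hx
    · exact (hD x hx).trans hrs
  refine ⟨fun x hx => ?_, fun x hx y hy => (hall x hx).trans (hall y hy).symm⟩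
  rw [Finset.mem_union, not_or] at hx
  have hxr : x ≠ r := fun h => hx.1 (h ▸ hr)
  have hxs : x ≠ s := fun h => hx.2 (h ▸ hs)
  rw [hWdef, Perm.mul_apply, Perm.mul_apply, swap_apply_of_ne_of_ne hxr hxs, hZ.1 x hx.2,
    hX.1 x hx.1]

theorem CycOn.mul_swap {X : S N} {A : Finset (Fin N)} (hX : CycOn X A) {r u : Fin N}
    (hr : r ∈ A) (hu : u ∉ A) : CycOn (X * swap r u) (insert u A) := by
  have h := hX.merge (cycOn_one_singleton u) (Finset.disjoint_singleton_right.mpr hu) hr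
    (Finset.mem_singleton_self u)
  rwa [mul_one, Finset.union_comm, ← Finset.insert_eq] at h

theorem CycOn.swap_mul {X : S N} {A : Finset (Fin N)} (hX : CycOn X A) {r u : Fin N}
    (hr : r ∈ A) (hu : u ∉ A) : CycOn (swap r u * X) (insert u A) := by
  have h := (hX.inv.mul_swap hr hu).inv
  rwa [mul_inv_rev, swap_inv, inv_inv] at h

/-- The product sends `r` directly to `X (X r)`, cutting `X r` out of the cycle as a fixed point. -/
theorem CycOn.mul_swap_erase {X : S N} {A : Finset (Fin N)} (hX : CycOn X A) {r : Fin N}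
    (hr : r ∈ A) : CycOn (X * swap r (X r)) (A.erase (X r)) := by
  set W := X * swap r (X r) with hWdef
  have hWa : W (X r) = X r := by rw [hWdef, Perm.mul_apply, swap_apply_right]
  have hW : ∀ x, x ≠ r → x ≠ X r → W x = X x := fun x h1 h2 => by
    rw [hWdef, Perm.mul_apply, swap_apply_of_ne_of_ne h1 h2]
  have key : ∀ x ∈ A.erase (X r), W.SameCycle x r := by
    intro x hx
    obtain ⟨hxa, hx⟩ := Finset.mem_erase.mp hx
    obtain ⟨k, hk⟩ := (hX.2 x hx r hr).exists_nat_pow_eq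
    induction k generalizing x with
    | zero => simp only [pow_zero, Perm.coe_one, id_eq] at hk; rw [hk]
    | succ k ih =>
      by_cases hxr : x = r
      · rw [hxr]
      · rw [pow_succ, Perm.mul_apply, ← hW x hxr hxa] at hk
        have hWx : W x ∈ A := hW x hxr hxa ▸ hX.apply_mem hx
        have hne' : W x ≠ X r := fun h => hxr (X.injective (hW x hxr hxa ▸ h))
        exact sameCycle_apply_left.mp (ih (W x) (Finset.mem_erase.mpr ⟨hne', hWx⟩) hne' hWx hk)
  refine ⟨fun x hx => ?_, fun x hx y hy => (key x hx).trans (key y hy).symm⟩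
  by_cases hxa : x = X r
  · rw [hxa, hWa]
  · have hxA : x ∉ A := fun h => hx (Finset.mem_erase.mpr ⟨hxa, h⟩)
    rw [hW x (fun h => hxA (h ▸ hr)) hxa, hX.1 x hxA]

theorem CycOn.isCycle {X : S N} {A : Finset (Fin N)} (hX : CycOn X A) (hA : 2 ≤ A.card) :
    X.IsCycle ∧ X.support = A := by
  have hmv : ∀ x ∈ A, X x ≠ x := by
    intro x hx hfix
    obtain ⟨y, hy, hyx⟩ := Finset.exists_mem_ne hA x
    obtain ⟨i, hi⟩ := hX.2 x hx y hy
    rw [Perm.zpow_apply_eq_self_of_apply_eq_self hfix] at hi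
    exact hyx hi.symm
  have hmem : ∀ x, X x ≠ x → x ∈ A := fun x hx => by_contra fun h => hx (hX.1 x h)
  constructor
  · obtain ⟨x, hx⟩ : A.Nonempty := Finset.card_pos.mp (by omega)
    exact ⟨x, hmv x hx, fun y hy => hX.2 x hx y (hmem y hy)⟩
  · ext x
    exact ⟨fun hx => hmem x (mem_support.mp hx), fun hx => mem_support.mpr (hmv x hx)⟩

theorem cycOn_support_of_isCycle {X : S N} (hX : X.IsCycle) : CycOn X X.support :=
  ⟨fun _ hx => notMem_support.mp hx,
    fun _ hx _ hy => hX.sameCycle (mem_support.mp hx) (mem_support.mp hy)⟩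

theorem CycOn.eq_one_of_card_le_one {X : S N} {A : Finset (Fin N)} (hX : CycOn X A)
    (hA : A.card ≤ 1) : X = 1 := by
  ext1 x
  by_cases hx : x ∈ A
  · exact Finset.card_le_one.mp hA _ (hX.apply_mem hx) _ hx
  · exact hX.1 x hx

theorem CycOn.exists_conj {X Y : S N} {A B : Finset (Fin N)} (hX : CycOn X A) (hY : CycOn Y B)
    (h : A.card = B.card) : ∃ g : S N, g * X * g⁻¹ = Y := by
  by_cases hA : 2 ≤ A.card
  · obtain ⟨hX1, hX2⟩ := hX.isCycle hA
    obtain ⟨hY1, hY2⟩ := hY.isCycle (h ▸ hA)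
    exact isConj_iff.mp (hX1.isConj hY1 (by rw [hX2, hY2, h]))
  · refine ⟨1, ?_⟩
    rw [hX.eq_one_of_card_le_one (by omega), hY.eq_one_of_card_le_one (by omega)]
    simp

theorem hammingDist_mul_right_le {X Y : S N} {B : Finset (Fin N)} (hY : ∀ x ∉ B, Y x = x) :
    hammingDist (⇑X) (⇑(X * Y)) ≤ B.card := by
  refine Finset.card_le_card fun a ha => ?_
  by_contra hB
  exact (Finset.mem_filter.mp ha).2 (by rw [Perm.mul_apply, hY a hB])

/-- Each extra point is inserted by one transposition, which costs Hamming distance at most 2. -/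
theorem CycOn.exists_grow {X : S N} {A : Finset (Fin N)} (hX : CycOn X A) (hA : A.Nonempty)
    {d : ℕ} (hd : A.card ≤ d) (hdN : d ≤ N) :
    ∃ (Y : S N) (B : Finset (Fin N)), CycOn Y B ∧ B.card = d ∧
      hammingDist (⇑X) (⇑Y) ≤ 2 * (d - A.card) := by
  induction d, hd using Nat.le_induction with
  | base => exact ⟨X, A, hX, rfl, by simp⟩
  | succ d hd ih =>
    obtain ⟨Y, B, hY, hB, hdist⟩ := ih (by omega)
    obtain ⟨r, hr⟩ : B.Nonempty := Finset.card_pos.mp (by have := hA.card_pos; omega)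
    obtain ⟨u, hu⟩ : ∃ u, u ∉ B := by
      by_contra! hall
      have := Finset.card_eq_iff_eq_univ B |>.mpr (Finset.eq_univ_iff_forall.mpr hall)
      rw [Fintype.card_fin] at this
      omega
    refine ⟨Y * swap r u, insert u B, hY.mul_swap hr hu, by rw [Finset.card_insert_of_notMem hu, hB],
      ?_⟩
    have h1 : hammingDist (⇑Y) (⇑(Y * swap r u)) ≤ 2 := by
      refine (hammingDist_mul_right_le (B := {r, u}) fun x hx => ?_).trans Finset.card_le_two
      simp only [Finset.mem_insert, Finset.mem_singleton, not_or] at hx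
      exact swap_apply_of_ne_of_ne hx.1 hx.2
    have h2 := hammingDist_triangle (⇑X) (⇑Y) (⇑(Y * swap r u))
    omega

/-! ### Factorizations into two cycles -/

/-- A nontrivial permutation is a product of a cycle on its support and a cycle through one point
of each of its nontrivial cycles. -/
theorem exists_cycOn_support_mul (p : S N) (hp : p ≠ 1) :
    ∃ (X Y : S N) (B : Finset (Fin N)), X * Y = p ∧ CycOn X p.support ∧ CycOn Y B ∧
      B ⊆ p.support ∧ B.card = permN p ∧ B.Nonempty := by
  induction p using cycle_induction_on with
  | base_one => exact absurd rfl hp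
  | base_cycles σ hσ =>
    obtain ⟨r, hr⟩ : σ.support.Nonempty := Finset.nonempty_iff_ne_empty.mpr fun h =>
      hp (support_eq_empty_iff.mp h)
    refine ⟨σ, 1, {r}, mul_one _, cycOn_support_of_isCycle hσ, cycOn_one_singleton r,
      Finset.singleton_subset_iff.mpr hr, ?_, Finset.singleton_nonempty r⟩
    rw [permN, cycleFactorsFinset_eq_singleton_self_iff.mpr hσ]
    rfl
  | induction_disjoint σ τ hd hσ _ ih =>
    have hsN : permN (σ * τ) = permN τ + 1 := by
      rw [permN, hd.cycleFactorsFinset_mul_eq_union,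
        Finset.card_union_of_disjoint hd.disjoint_cycleFactorsFinset,
        cycleFactorsFinset_eq_singleton_self_iff.mpr hσ, permN]
      simp [add_comm]
    obtain ⟨s, hs⟩ : σ.support.Nonempty := Finset.nonempty_iff_ne_empty.mpr fun h =>
      hσ.ne_one (support_eq_empty_iff.mp h)
    have hσ' := cycOn_support_of_isCycle hσ
    rw [hsN, hd.support_mul]
    by_cases hτ : τ = 1
    · refine ⟨σ, 1, {s}, by rw [hτ], by simpa [hτ] using hσ', cycOn_one_singleton s,
        Finset.singleton_subset_iff.mpr (Finset.mem_union_left _ hs), ?_,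
        Finset.singleton_nonempty s⟩
      simp [hτ, permN]
    · obtain ⟨X, Y, B, hXY, hX, hY, hB, hBc, r, hr⟩ := ih hτ
      have hsτ : s ∉ τ.support := Finset.disjoint_left.mp hd.disjoint_support hs
      have hsB : s ∉ B := fun h => hsτ (hB h)
      -- The inserted transposition joins the new cycle `σ` to `X` and adds a single point `s` of
      -- `σ` to `Y`; its two copies cancel in the product.
      refine ⟨σ * X * swap s r, swap r s * Y, insert s B, ?_, ?_, hY.swap_mul hr hsB, ?_, ?_,
        Finset.insert_nonempty s B⟩
      · rw [swap_comm s r, mul_assoc, swap_mul_self_mul, mul_assoc, hXY]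
      · exact hσ'.merge hX hd.disjoint_support hs (hB hr)
      · exact Finset.insert_subset (Finset.mem_union_left _ hs)
          (hB.trans Finset.subset_union_right)
      · rw [Finset.card_insert_of_notMem hsB, hBc]

theorem hammingDist_conj (g p q : S N) :
    hammingDist (⇑(g * p * g⁻¹)) (⇑(g * q * g⁻¹)) = hammingDist (⇑p) (⇑q) := by
  unfold hammingDist
  refine Finset.card_equiv g⁻¹ fun i => ?_
  rw [Finset.mem_filter_univ, Finset.mem_filter_univ]
  simp [Perm.mul_apply]

/-- A cycle on `A` is conjugate to `σ` up to an error in the Hamming distance. -/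
theorem CycOn.exists_conj_near {X : S N} {A : Finset (Fin N)} (hX : CycOn X A) (hA : A.Nonempty)
    (σ : S N) : ∃ g : S N, hammingDist (⇑(g * X * g⁻¹)) (⇑σ) ≤
      2 * ((A.card - permM σ) + (permM σ - A.card)) + permN σ := by
  have hAN : A.card ≤ N := by simpa using Finset.card_le_univ A
  by_cases hσ : σ = 1
  · refine ⟨1, ?_⟩
    have h := hammingDist_mul_right_le (X := 1) (Y := X) hX.1
    have h0 : permM (1 : S N) = 0 := by simp [permM]
    rw [hσ, h0, hammingDist_comm]
    simp only [one_mul, inv_one, mul_one] at h ⊢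
    omega
  -- `σ` differs from the cycle `Z` on its support at no more than `permN σ` points. It remains to
  -- lengthen the shorter of `X` and `Z`; of the two truncated differences in the bound, one is
  -- zero.
  obtain ⟨Z, Y, B, hZY, hZ, hY, -, hBc, -⟩ := exists_cycOn_support_mul σ hσ
  have hZσ : hammingDist (⇑Z) (⇑σ) ≤ permN σ := by
    rw [← hBc, ← hZY]
    exact hammingDist_mul_right_le hY.1
  have hσN : permM σ ≤ N := by simpa [permM] using Finset.card_le_univ σ.support
  rcases le_total A.card (permM σ) with hle | hle
  · obtain ⟨X', A', hX', hA', hd⟩ := hX.exists_grow hA hle hσN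
    obtain ⟨g, hg⟩ := hX'.exists_conj hZ hA'
    refine ⟨g, ?_⟩
    have h1 := hammingDist_conj g X X'
    have h2 := hammingDist_triangle (⇑(g * X * g⁻¹)) (⇑Z) (⇑σ)
    rw [hg] at h1
    omega
  · have hne : σ.support.Nonempty := Finset.nonempty_iff_ne_empty.mpr fun h =>
      hσ (support_eq_empty_iff.mp h)
    obtain ⟨Z', A', hZ', hA', hd⟩ := hZ.exists_grow hne hle hAN
    obtain ⟨g, hg⟩ := hX.exists_conj hZ' hA'.symm
    refine ⟨g, ?_⟩
    have h2 := hammingDist_triangle (⇑(g * X * g⁻¹)) (⇑Z) (⇑σ)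
    rw [hg, hammingDist_comm (⇑Z') (⇑Z)] at h2
    rw [hg]
    unfold permM at *
    omega

/-- `p` is a product of a cycle on `A` and a cycle on `B`, where `A` and `B` intersect, and
`i`, `x`, `y` are the cardinalities of `A ∩ B`, `A \ B`, `B \ A`. -/
def FactorsAs (p : S N) (i x y : ℕ) : Prop :=
  ∃ (X Y : S N) (A B : Finset (Fin N)), X * Y = p ∧ CycOn X A ∧ CycOn Y B ∧
    (A ∩ B).Nonempty ∧ (A ∩ B).card = i ∧ (A \ B).card = x ∧ (B \ A).card = y

theorem permM_le (p : S N) : permM p ≤ N := by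
  simpa [permM] using Finset.card_le_univ p.support

/-- The correction `e` is 1 only for the identity, whose empty support provides no common point; the
two trivial cycles on `{0}` serve instead. -/
theorem exists_factorsAs [NeZero N] (p : S N) :
    ∃ e ≤ 1, permM p + e ≤ N ∧ FactorsAs p (permN p + e) (permM p - permN p) 0 := by
  by_cases hp : p = 1
  · have hN := Nat.pos_of_ne_zero (NeZero.ne N)
    refine ⟨1, le_rfl, by rw [hp, permM]; simpa [Nat.one_le_iff_ne_zero] using hN.ne', 1, 1, {0}, {0}, by rw [hp, one_mul], cycOn_one_singleton 0,
      cycOn_one_singleton 0, by simp, ?_, ?_, ?_⟩ <;> simp [hp, permM, permN]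
  · obtain ⟨X, Y, B, hXY, hX, hY, hB, hBc, hBn⟩ := exists_cycOn_support_mul p hp
    refine ⟨0, zero_le_one, permM_le p, X, Y, p.support, B, hXY, hX, hY, ?_, ?_, ?_, ?_⟩
    · rwa [Finset.inter_eq_right.mpr hB]
    · rw [Finset.inter_eq_right.mpr hB, hBc, add_zero]
    · rw [Finset.card_sdiff_of_subset hB, hBc, permM]
    · rw [Finset.sdiff_eq_empty_iff_subset.mpr hB, Finset.card_empty]

theorem FactorsAs.add_fresh {p : S N} {i x y : ℕ} (h : FactorsAs p i x y) (hN : i + x + y < N) :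
    FactorsAs p (i + 1) x y := by
  obtain ⟨X, Y, A, B, hXY, hX, hY, ⟨r, hr⟩, hi, hx, hy⟩ := h
  obtain ⟨f, hf⟩ : ∃ f, f ∉ A ∪ B := by
    by_contra! hall
    have h1 := Finset.card_eq_iff_eq_univ (A ∪ B) |>.mpr (Finset.eq_univ_iff_forall.mpr hall)
    rw [Fintype.card_fin] at h1
    have h2 := Finset.card_union_add_card_inter A B
    have h3 := Finset.card_inter_add_card_sdiff A B
    have h4 := Finset.card_inter_add_card_sdiff B A
    rw [Finset.inter_comm] at h4
    omega
  rw [Finset.mem_inter] at hr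
  rw [Finset.mem_union, not_or] at hf
  refine ⟨X * swap r f, swap r f * Y, insert f A, insert f B, ?_, hX.mul_swap hr.1 hf.1,
    hY.swap_mul hr.2 hf.2, ⟨f, by simp⟩, ?_, ?_, ?_⟩
  · rw [mul_assoc, swap_mul_self_mul, hXY]
  · rw [← Finset.insert_inter_distrib, Finset.card_insert_of_notMem, hi]
    simp [hf.1]
  · rw [← hx]
    congr 1
    ext a
    simp only [Finset.mem_sdiff, Finset.mem_insert]
    constructor
    · tauto
    · rintro ⟨h1, h2⟩
      exact ⟨Or.inr h1, fun h => h.elim (fun h => hf.1 (h ▸ h1)) h2⟩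
  · rw [← hy]
    congr 1
    ext a
    simp only [Finset.mem_sdiff, Finset.mem_insert]
    constructor
    · tauto
    · rintro ⟨h1, h2⟩
      exact ⟨Or.inr h1, fun h => h.elim (fun h => hf.2 (h ▸ h1)) h2⟩

theorem FactorsAs.transfer {p : S N} {i x y : ℕ} (h : FactorsAs p i (x + 1) y) :
    FactorsAs p i x (y + 1) := by
  obtain ⟨X, Y, A, B, hXY, hX, hY, ⟨s, hs⟩, hi, hx, hy⟩ := h
  obtain ⟨b, hb⟩ : (A \ B).Nonempty := Finset.card_pos.mp (by omega)
  rw [Finset.mem_inter] at hs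
  rw [Finset.mem_sdiff] at hb
  -- Going along the cycle `X` from a common point `s` to a point `b` outside `B`, there is a last
  -- step inside `B`. The point `X r` after it is the one transferred.
  obtain ⟨r, hrA, hrB, hrn⟩ : ∃ r ∈ A, r ∈ B ∧ X r ∉ B := by
    by_contra! hall
    obtain ⟨k, hk⟩ := (hX.2 s hs.1 b hb.1).exists_nat_pow_eq
    have hmem : ∀ k : ℕ, (X ^ k) s ∈ A ∧ (X ^ k) s ∈ B := by
      intro k
      induction k with
      | zero => exact hs
      | succ k ih =>
        rw [pow_succ', Perm.mul_apply]
        exact ⟨hX.apply_mem ih.1, hall _ ih.1 ih.2⟩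
    exact hb.2 (hk ▸ (hmem k).2)
  have hXA := hX.apply_mem hrA
  have hint : A.erase (X r) ∩ insert (X r) B = A ∩ B := by
    ext a
    simp only [Finset.mem_inter, Finset.mem_erase, Finset.mem_insert]
    constructor
    · tauto
    · rintro ⟨h1, h2⟩
      exact ⟨⟨fun h => hrn (h ▸ h2), h1⟩, Or.inr h2⟩
  refine ⟨X * swap r (X r), swap r (X r) * Y, A.erase (X r), insert (X r) B, ?_,
    hX.mul_swap_erase hrA, hY.swap_mul hrB hrn, ?_, ?_, ?_, ?_⟩
  · rw [mul_assoc, swap_mul_self_mul, hXY]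
  · rw [hint]
    exact ⟨s, Finset.mem_inter.mpr hs⟩
  · rw [hint, hi]
  · have : A.erase (X r) \ insert (X r) B = (A \ B).erase (X r) := by
      ext a
      simp only [Finset.mem_sdiff, Finset.mem_erase, Finset.mem_insert]
      tauto
    rw [this, Finset.card_erase_of_mem (Finset.mem_sdiff.mpr ⟨hXA, hrn⟩), hx]
    rfl
  · have : insert (X r) B \ A.erase (X r) = insert (X r) (B \ A) := by
      ext a
      simp only [Finset.mem_sdiff, Finset.mem_erase, Finset.mem_insert]
      tauto
    rw [this, Finset.card_insert_of_notMem (by simp [hrn]), hy]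

theorem FactorsAs.cross {p : S N} {i x y : ℕ} (h : FactorsAs p i (x + 1) (y + 1)) :
    FactorsAs p (i + 2) x y := by
  obtain ⟨X, Y, A, B, hXY, hX, hY, -, hi, hx, hy⟩ := h
  obtain ⟨v, hv⟩ : (A \ B).Nonempty := Finset.card_pos.mp (by omega)
  obtain ⟨u, hu⟩ : (B \ A).Nonempty := Finset.card_pos.mp (by omega)
  have hv' := Finset.mem_sdiff.mp hv
  have hu' := Finset.mem_sdiff.mp hu
  have huv : u ≠ v := fun h => hu'.2 (h ▸ hv'.1)
  have hint : insert u A ∩ insert v B = insert u (insert v (A ∩ B)) := by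
    ext a
    simp only [Finset.mem_inter, Finset.mem_insert]
    constructor
    · tauto
    · rintro (rfl | rfl | h)
      · exact ⟨Or.inl rfl, Or.inr hu'.1⟩
      · exact ⟨Or.inr hv'.1, Or.inl rfl⟩
      · exact ⟨Or.inr h.1, Or.inr h.2⟩
  -- The same transposition brings `u` into the cycle of `X` at `v`, and `v` into the cycle of `Y`
  -- at `u`.
  refine ⟨X * swap v u, swap v u * Y, insert u A, insert v B, ?_, hX.mul_swap hv'.1 hu'.2,
    swap_comm u v ▸ hY.swap_mul hu'.1 hv'.2, ?_, ?_, ?_, ?_⟩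
  · rw [mul_assoc, swap_mul_self_mul, hXY]
  · rw [hint]
    exact Finset.insert_nonempty _ _
  · rw [hint, Finset.card_insert_of_notMem, Finset.card_insert_of_notMem, hi]
    · simp [hv'.2]
    · simp [huv, hu'.2]
  · have : insert u A \ insert v B = (A \ B).erase v := by
      ext a
      simp only [Finset.mem_sdiff, Finset.mem_erase, Finset.mem_insert]
      constructor
      · rintro ⟨rfl | h1, h2⟩
        · exact absurd (Or.inr hu'.1) h2
        · tauto
      · tauto
    rw [this, Finset.card_erase_of_mem hv, hx]
    rfl
  · have : insert v B \ insert u A = (B \ A).erase u := by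
      ext a
      simp only [Finset.mem_sdiff, Finset.mem_erase, Finset.mem_insert]
      constructor
      · rintro ⟨rfl | h1, h2⟩
        · exact absurd (Or.inr hv'.1) h2
        · tauto
      · tauto
    rw [this, Finset.card_erase_of_mem hu, hy]
    rfl

/-- Apply `f` fresh points, then `t` transfers, then `c` crossings. Only a fresh point enlarges A ∪
B, whence `hf`; a crossing uses up one point of each difference, whence `htc` and `hct`. -/
theorem FactorsAs.iterate {p : S N} {i x : ℕ} (h : FactorsAs p i x 0) {f t c : ℕ}
    (hf : i + x + f ≤ N) (htc : t + c ≤ x) (hct : c ≤ t) :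
    FactorsAs p (i + f + 2 * c) (x - t - c) (t - c) := by
  have h1 : ∀ f, i + x + f ≤ N → FactorsAs p (i + f) x 0 := by
    intro f
    induction f with
    | zero => exact fun _ => h
    | succ f ih => exact fun hf => (ih (by omega)).add_fresh (by omega)
  have h2 : ∀ t ≤ x, FactorsAs p (i + f) (x - t) t := by
    intro t
    induction t with
    | zero => exact fun _ => h1 f hf
    | succ t ih =>
      intro ht
      have h3 := ih (by omega)
      rw [show x - t = x - (t + 1) + 1 by omega] at h3
      exact h3.transfer
  have h3 : ∀ c, t + c ≤ x → c ≤ t → FactorsAs p (i + f + 2 * c) (x - t - c) (t - c) := by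
    intro c
    induction c with
    | zero => exact fun ht _ => h2 t ht
    | succ c ih =>
      intro ht hc
      have h4 := ih (by omega) (by omega)
      rw [show x - t - c = x - t - (c + 1) + 1 by omega,
        show t - c = t - (c + 1) + 1 by omega] at h4
      exact h4.cross
  exact h3 c htc hct

theorem two_mul_permN_le (p : S N) : 2 * permN p ≤ permM p := by
  unfold permN permM
  rw [← sum_cycleType, mul_comm, ← smul_eq_mul]
  have hc : p.cycleFactorsFinset.card = p.cycleType.card := by
    rw [cycleType_def, Multiset.card_map, Finset.card_val]
  rw [hc]
  exact Multiset.card_nsmul_le_sum fun x hx => two_le_of_mem_cycleType hx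

theorem permN_le (p : S N) : permN p ≤ N := by
  have := two_mul_permN_le p
  have := permM_le p
  omega

/-- Solves |A| = m + e + f + c - t ≈ a and |B| = n + e + f + c + t ≈ b in natural numbers. The error
10E + 10 generously absorbs rounding, `e` and the slack `E`. -/
theorem exists_factorization_parameters {N m n a b e E : ℕ} (hmn : n ≤ m) (he : e ≤ 1)
    (hme : m + e ≤ N) (ha : a ≤ N) (hba : b ≤ a + E) (h1 : m + n ≤ a + b + E)
    (h2 : a + n ≤ b + m + E) :
    ∃ f t c : ℕ, m + e + f ≤ N ∧ t + c ≤ m - n ∧ c ≤ t ∧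
      m + e + f + c ≤ a + t + (10 * E + 10) ∧ a + t ≤ m + e + f + c + (10 * E + 10) ∧
      n + e + f + c + t ≤ b + (10 * E + 10) ∧ b ≤ n + e + f + c + t + (10 * E + 10) := by
  obtain ⟨d, rfl⟩ := Nat.exists_eq_add_of_le hmn
  -- Fresh points are needed only when the longer cycle must exceed the support of `p`.
  have hf : ∃ f, n + d + e + f ≤ N ∧ (a ≤ n + d + e ∧ f = 0 ∨ n + d + e + f = a) := by
    rcases le_total a (n + d + e) with h | h
    · exact ⟨0, by omega, Or.inl ⟨h, rfl⟩⟩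
    · exact ⟨a - (n + d + e), by omega, Or.inr (by omega)⟩
  obtain ⟨f, hfN, hf⟩ := hf
  -- Subtracting the two equations gives 2t ≈ d - (a - b), nonnegative up to `E` by `h2` and at most
  -- d up to `E` by `hba`; hence the clamping to 0 or d / 2.
  have ht : ∃ t ≤ d, 2 * t + a ≤ d + b + E ∧ d + b ≤ 2 * t + a + E + 1 := by
    rcases le_total (d + b) a with h | h
    · exact ⟨0, by omega, by omega, by omega⟩
    · rcases le_total b a with h' | h'
      · exact ⟨(d + b - a) / 2, by omega, by omega, by omega⟩
      · exact ⟨d / 2, by omega, by omega, by omega⟩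
  obtain ⟨t, htd, ht1, ht2⟩ := ht
  -- Adding the equations gives 2c ≈ a + b - (2f + 2n + d). This is nonnegative up to error by `h1`
  -- if f = 0 and by `h2` otherwise. The limits c ≤ t and t + c ≤ d amount, up to error, to a ≤ m +
  -- f and b ≤ m + f, so `c` is truncated at them at bounded cost.
  have hc : ∃ c, c ≤ t ∧ t + c ≤ d ∧ 2 * c + 2 * f + 2 * n + d ≤ a + b + 4 * E + 8 ∧
      a + b ≤ 2 * c + 2 * f + 2 * n + d + 4 * E + 8 := by
    have hfa : a ≤ n + d + f + 1 := by omega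
    have hf2 : 2 * f + 2 * n + d ≤ a + b + E + 2 := by
      rcases hf with hf | hf <;> omega
    clear hf
    by_cases h : a + b ≤ 2 * f + 2 * n + d
    · exact ⟨0, by omega, by omega, by omega, by omega⟩
    obtain ⟨z, hz⟩ := Nat.exists_eq_add_of_le (not_le.mp h).le
    rcases le_total (z / 2) t with h3 | h3
    · rcases le_total (t + z / 2) d with h4 | h4
      · exact ⟨z / 2, h3, h4, by omega, by omega⟩
      · exact ⟨d - t, by omega, by omega, by omega, by omega⟩
    · rcases le_total (t + t) d with h4 | h4
      · exact ⟨t, le_rfl, h4, by omega, by omega⟩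
      · exact ⟨d - t, by omega, by omega, by omega, by omega⟩
  obtain ⟨c, hct, htc, hc1, hc2⟩ := hc
  refine ⟨f, t, c, hfN, by omega, hct, ?_, ?_, ?_, ?_⟩ <;> omega

/-- A permutation satisfying the two inequalities up to `E` is a product of two cycles of lengths
`a` and `b`, up to a multiple of `E`. -/
theorem exists_mul_cycOn (hN : 0 < N) (p : S N) {a b E : ℕ} (ha : a ≤ N) (hba : b ≤ a + E)
    (h1 : permM p + permN p ≤ a + b + E) (h2 : a + permN p ≤ b + permM p + E) :
    ∃ (X Y : S N) (A B : Finset (Fin N)), X * Y = p ∧ CycOn X A ∧ CycOn Y B ∧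
      A.Nonempty ∧ B.Nonempty ∧
      A.card ≤ a + (10 * E + 10) ∧ a ≤ A.card + (10 * E + 10) ∧
      B.card ≤ b + (10 * E + 10) ∧ b ≤ B.card + (10 * E + 10) := by
  have : NeZero N := ⟨hN.ne'⟩
  obtain ⟨e, he, hme, h⟩ := exists_factorsAs p
  have hmn : permN p ≤ permM p := by have := two_mul_permN_le p; omega
  obtain ⟨f, t, c, hf, htc, hct, hA1, hA2, hB1, hB2⟩ :=
    exists_factorization_parameters hmn he hme ha hba h1 h2
  obtain ⟨X, Y, A, B, hXY, hX, hY, hAB, hi, hx, hy⟩ :=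
    h.iterate (f := f) (t := t) (c := c) (by omega) htc hct
  have h3 := Finset.card_inter_add_card_sdiff A B
  have h4 := Finset.card_inter_add_card_sdiff B A
  rw [Finset.inter_comm] at h4
  have hAc : A.card + t = permM p + e + f + c := by omega
  have hBc : B.card = permN p + e + f + c + t := by omega
  refine ⟨X, Y, A, B, hXY, hX, hY, hAB.mono Finset.inter_subset_left,
    hAB.mono Finset.inter_subset_right, ?_, ?_, ?_, ?_⟩ <;> omega

/-! ### Counting the cycles of a product -/

/-- If the cycles of `p` that avoid `T` all lie in `Q`, then `p` has at most `#T + #Q` cycles. -/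
theorem permN_le_of_forall_avoiding (p : S N) (T : Finset (Fin N)) (Q : Finset (S N))
    (h : ∀ c ∈ p.cycleFactorsFinset, (∀ a ∈ c.support, a ∉ T) → c ∈ Q) :
    permN p ≤ T.card + Q.card := by
  have hsub : (p.cycleFactorsFinset \ Q).card ≤ T.card := by
    rcases isEmpty_or_nonempty (Fin N) with hN | hN
    · have hsub : Subsingleton (S N) := inferInstance
      have : p.cycleFactorsFinset = ∅ := by
        rw [cycleFactorsFinset_eq_empty_iff]
        exact Subsingleton.elim _ _
      simp [this]
    have key : ∀ c ∈ p.cycleFactorsFinset \ Q, ∃ a, a ∈ c.support ∧ a ∈ T := by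
      intro c hc
      rw [Finset.mem_sdiff] at hc
      by_contra! hall
      exact hc.2 (h c hc.1 hall)
    choose! g hg using key
    refine Finset.card_le_card_of_injOn g (fun c hc => (hg c hc).2) fun c hc d hd hcd => ?_
    by_contra hne
    have hdis := cycleFactorsFinset_pairwise_disjoint p
      (Finset.mem_sdiff.mp hc).1 (Finset.mem_sdiff.mp hd).1 hne
    exact Finset.disjoint_left.mp hdis.disjoint_support (hg c hc).1 (hcd ▸ (hg d hd).1)
  have := Finset.card_le_card_sdiff_add_card (s := p.cycleFactorsFinset) (t := Q)
  unfold permN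
  omega

theorem mem_cycleFactorsFinset_of_agree {p q c : S N} (hc : c ∈ p.cycleFactorsFinset)
    (h : ∀ a ∈ c.support, p a = q a) : c ∈ q.cycleFactorsFinset := by
  rw [mem_cycleFactorsFinset_iff] at hc ⊢
  exact ⟨hc.1, fun a ha => (hc.2 a ha).trans (h a ha)⟩

theorem permM_add_permN_mul_le (x y : S N) :
    permM (x * y) + permN (x * y) ≤ permM x + permN x + (permM y + permN y) := by
  have h1 : permM (x * y) ≤ (x.support ∪ y.support).card :=
    Finset.card_le_card (support_mul_le x y)
  have h2 := Finset.card_union_add_card_inter x.support y.support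
  have h3 : permN (x * y) ≤ (x.support ∩ y.support).card
      + (x.cycleFactorsFinset ∪ y.cycleFactorsFinset).card := by
    refine permN_le_of_forall_avoiding _ _ _ fun c hc hav => ?_
    have hav' : ∀ a ∈ c.support, x a ≠ a → y a = a := by
      intro a ha hx
      have := hav a ha
      rw [Finset.mem_inter, not_and, mem_support, notMem_support] at this
      exact this hx
    obtain ⟨hcyc, hcp⟩ := mem_cycleFactorsFinset_iff.mp hc
    rw [Finset.mem_union]
    by_cases hS : ∃ s ∈ c.support, x s ≠ s
    · obtain ⟨s, hs, hxs⟩ := hS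
      -- Outside the common support, a point moved by `x` is fixed by `y`, and its image is again
      -- moved by `x`. So a cycle with one such point lies wholly in the support of `x` and is a
      -- cycle of `x`.
      have hstep : ∀ k : ℕ, (c ^ k) s ∈ c.support ∧ x ((c ^ k) s) ≠ (c ^ k) s := by
        intro k
        induction k with
        | zero => exact ⟨hs, hxs⟩
        | succ k ih =>
          rw [pow_succ', Perm.mul_apply]
          refine ⟨apply_mem_support.mpr ih.1, ?_⟩
          rw [hcp _ ih.1, Perm.mul_apply, hav' _ ih.1 ih.2]
          exact fun h => ih.2 (x.injective h)
      refine Or.inl (mem_cycleFactorsFinset_of_agree hc fun a ha => ?_)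
      obtain ⟨k, rfl⟩ := (hcyc.sameCycle (mem_support.mp hs)
        (mem_support.mp ha)).exists_nat_pow_eq
      rw [Perm.mul_apply, hav' _ ha (hstep k).2]
    · push Not at hS
      refine Or.inr (mem_cycleFactorsFinset_of_agree hc fun a ha => ?_)
      have h4 := hS (c a) (apply_mem_support.mpr ha)
      rw [hcp a ha, Perm.mul_apply] at h4
      rw [Perm.mul_apply]
      exact x.injective h4
  have h4 := Finset.card_union_le x.cycleFactorsFinset y.cycleFactorsFinset
  unfold permN permM at *
  omega

theorem permM_add_permN_mul_le' (x y : S N) :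
    permM x + permN (x * y) ≤ permM (x * y) + permM y + permN x := by
  have h1 : permM x ≤ ((x * y).support ∪ y.support).card := by
    have h := Finset.card_le_card (support_mul_le (x * y) y⁻¹)
    rwa [mul_inv_cancel_right, support_inv] at h
  have h2 := Finset.card_union_add_card_inter (x * y).support y.support
  have h3 : permN (x * y) ≤ ((x * y).support ∩ y.support).card + x.cycleFactorsFinset.card := by
    refine permN_le_of_forall_avoiding _ _ _ fun c hc hav => ?_
    refine mem_cycleFactorsFinset_of_agree hc fun a ha => ?_
    have h4 := hav a ha
    rw [Finset.mem_inter, not_and, notMem_support] at h4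
    rw [Perm.mul_apply, h4 (mem_cycleFactorsFinset_support_le hc ha)]
  unfold permN permM at *
  omega

theorem permM_conj (g p : S N) : permM (g * p * g⁻¹) = permM p := by
  unfold permM
  exact card_support_conj

theorem permN_eq_card_cycleType (p : S N) : permN p = p.cycleType.card := by
  rw [permN, cycleType_def, Multiset.card_map, Finset.card_val]

theorem permN_conj (g p : S N) : permN (g * p * g⁻¹) = permN p := by
  rw [permN_eq_card_cycleType, permN_eq_card_cycleType, cycleType_conj]

theorem permCyc_one_add_permM (p : S N) : permCyc 1 p + permM p = N := by
  have h : (p.cycleFactorsFinset.filter (fun c => c.support.card = 1)) = ∅ := by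
    refine Finset.filter_eq_empty_iff.mpr fun c hc h1 => ?_
    have := (mem_cycleFactorsFinset_iff.mp hc).1.two_le_card_support
    omega
  have := permM_le p
  unfold permCyc permM at *
  rw [count_parts, h]
  simp only [Finset.card_empty, if_true]
  omega

/-- Cycles of length at most `L` are counted by the `permCyc i` with 2 ≤ i ≤ L; fewer than or equal
to N / L are longer, being disjoint. -/
theorem mul_permN_le (p : S N) (L : ℕ) :
    L * permN p ≤ L * ∑ i ∈ Finset.Icc 2 L, permCyc i p + N := by
  have hle : (p.cycleFactorsFinset.filter (fun c => c.support.card ≤ L)).card ≤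
      ∑ i ∈ Finset.Icc 2 L, permCyc i p := by
    rw [Finset.card_eq_sum_card_fiberwise (t := Finset.Icc 2 L) (f := fun c => c.support.card)]
    · refine Finset.sum_le_sum fun i hi => ?_
      rw [Finset.mem_Icc] at hi
      unfold permCyc
      rw [count_parts, Finset.filter_filter]
      refine le_trans (Finset.card_le_card ?_)
        (le_trans (Nat.le_add_right _ _) (Nat.le_mul_of_pos_left _ (by omega)))
      intro c hc
      rw [Finset.mem_filter] at hc ⊢
      exact ⟨hc.1, hc.2.2⟩
    · intro c hc
      have hc' := Finset.mem_filter.mp hc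
      exact Finset.mem_Icc.mpr
        ⟨(mem_cycleFactorsFinset_iff.mp hc'.1).1.two_le_card_support, hc'.2⟩
  have hgt : L * (p.cycleFactorsFinset.filter (fun c => ¬ c.support.card ≤ L)).card ≤ N := by
    have h1 : (p.cycleFactorsFinset.filter (fun c => ¬ c.support.card ≤ L)).card • L ≤
        ∑ c ∈ p.cycleFactorsFinset.filter (fun c => ¬ c.support.card ≤ L), c.support.card :=
      Finset.card_nsmul_le_sum _ _ _ fun c hc => (not_le.mp (Finset.mem_filter.mp hc).2).le
    have h2 := Finset.sum_le_sum_of_subset (f := fun c : S N => c.support.card)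
      (Finset.filter_subset (fun c => ¬ c.support.card ≤ L) p.cycleFactorsFinset)
    have h3 : ∑ c ∈ p.cycleFactorsFinset, c.support.card = permM p := by
      rw [permM, ← sum_cycleType, cycleType_def]
      rfl
    have h4 := permM_le p
    rw [smul_eq_mul, mul_comm] at h1
    exact h1.trans (h2.trans (h3.trans_le h4))
  have hsum := Finset.card_filter_add_card_filter_not (s := p.cycleFactorsFinset)
    (fun c => c.support.card ≤ L)
  unfold permN
  rw [← hsum, mul_add]
  exact add_le_add (Nat.mul_le_mul_left L hle) hgt

/-! ### Limits along the ultrafilter -/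

variable {n : ℕ → ℕ} {ω : Ultrafilter ℕ}

theorem tendsto_permM (p : ∀ k, S (n k)) :
    Tendsto (fun k => (permM (p k) : ℝ) / n k) ω (𝓝 (m (QuotientGroup.mk p : USofic n ω))) :=
  tendsto_ultraLim @permM unifLip_permM (fun _ p => permM_le p) p

theorem tendsto_permN (p : ∀ k, S (n k)) :
    Tendsto (fun k => (permN (p k) : ℝ) / n k) ω
      (𝓝 (numCyc (QuotientGroup.mk p : USofic n ω))) :=
  tendsto_ultraLim @permN unifLip_permN (fun _ p => permN_le p) p

theorem tendsto_permCyc (i : ℕ) (p : ∀ k, S (n k)) :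
    Tendsto (fun k => (permCyc i (p k) : ℝ) / n k) ω
      (𝓝 (cyc i (QuotientGroup.mk p : USofic n ω))) :=
  tendsto_ultraLim (@permCyc i) (unifLip_permCyc i) (fun _ p => permCyc_le i p) p

theorem cyc_one_eq (hn : ∀ k, 0 < n k) (q : USofic n ω) : cyc 1 q = 1 - m q := by
  obtain ⟨q, rfl⟩ := QuotientGroup.mk_surjective q
  refine tendsto_nhds_unique (tendsto_permCyc 1 q) ?_
  refine (tendsto_const_nhds.sub (tendsto_permM q)).congr fun k => ?_
  have h0 : (n k : ℝ) ≠ 0 := by exact_mod_cast (hn k).ne'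
  have h : (permCyc 1 (q k) : ℝ) + permM (q k) = n k := by
    exact_mod_cast permCyc_one_add_permM (q k)
  field_simp
  linarith

theorem cycInf_eq_m (hn : ∀ k, 0 < n k) {q : USofic n ω} (hq : q ∈ cycOneInf n ω) :
    cycInf q = m q := by
  have h : ∑' i : ℕ, cyc (i + 1) q = cyc 1 q :=
    tsum_eq_single 0 fun i hi => hq (i + 1) (by omega)
  rw [cycInf, h, cyc_one_eq hn, sub_sub_cancel]

theorem numCyc_eq_zero (hn : ∀ k, 0 < n k) {q : USofic n ω} (hq : q ∈ cycOneInf n ω) :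
    numCyc q = 0 := by
  obtain ⟨q, rfl⟩ := QuotientGroup.mk_surjective q
  have h0 : 0 ≤ numCyc (QuotientGroup.mk q : USofic n ω) :=
    ge_of_tendsto' (tendsto_permN q) fun k => by positivity
  -- The short-cycle terms vanish in the limit, leaving numCyc ≤ 1 / L for every positive `L`.
  have hL : ∀ L : ℕ, L * numCyc (QuotientGroup.mk q : USofic n ω) ≤ 1 := by
    intro L
    have h1 : Tendsto (fun k => (L : ℝ) * ∑ i ∈ Finset.Icc 2 L, (permCyc i (q k) : ℝ) / n k + 1) ω
        (𝓝 (L * ∑ i ∈ Finset.Icc 2 L, cyc i (QuotientGroup.mk q : USofic n ω) + 1)) :=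
      ((tendsto_finsetSum _ fun i _ => tendsto_permCyc i q).const_mul _).add_const _
    rw [Finset.sum_eq_zero fun i hi => hq i (Finset.mem_Icc.mp hi).1, mul_zero, zero_add] at h1
    refine le_of_tendsto_of_tendsto' ((tendsto_permN q).const_mul _) h1 fun k => ?_
    have hpos : (0 : ℝ) < n k := by exact_mod_cast hn k
    have h2 : (L : ℝ) * permN (q k) ≤ L * ∑ i ∈ Finset.Icc 2 L, (permCyc i (q k) : ℝ) + n k := by
      exact_mod_cast mul_permN_le (q k) L
    rw [← Finset.sum_div, ← mul_div_assoc, ← mul_div_assoc, div_add_one hpos.ne']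
    exact div_le_div_of_nonneg_right h2 hpos.le
  by_contra hne
  obtain ⟨L, hL'⟩ := exists_nat_gt (1 / numCyc (QuotientGroup.mk q : USofic n ω))
  rw [div_lt_iff₀ (lt_of_le_of_ne h0 (Ne.symm hne))] at hL'
  linarith [hL L]

theorem mk_eq_mk_of_tendsto {p q : ∀ k, S (n k)}
    (h : Tendsto (fun k => dHamm (p k) (q k)) ω (𝓝 0)) :
    (QuotientGroup.mk p : USofic n ω) = QuotientGroup.mk q := by
  rw [QuotientGroup.eq]
  refine h.congr fun k => ?_
  have h1 := dHamm_mul_left (p k) ((p k)⁻¹ * q k) 1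
  rw [mul_inv_cancel_left, mul_one] at h1
  rw [dHamm_comm, h1]
  rfl

theorem isConj_mk_of_tendsto {p q : ∀ k, S (n k)} {e : ℕ → ℕ}
    (h : ∀ k, ∃ g : S (n k), hammingDist (⇑(g * p k * g⁻¹)) (⇑(q k)) ≤ e k)
    (he : Tendsto (fun k => (e k : ℝ) / n k) ω (𝓝 0)) :
    IsConj (QuotientGroup.mk p : USofic n ω) (QuotientGroup.mk q) := by
  choose g hg using h
  refine isConj_iff.mpr ⟨QuotientGroup.mk g, ?_⟩
  rw [← QuotientGroup.mk_inv, ← QuotientGroup.mk_mul, ← QuotientGroup.mk_mul]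
  refine mk_eq_mk_of_tendsto (squeeze_zero (fun k => dHamm_nonneg _ _) (fun k => ?_) he)
  unfold dHamm
  gcongr
  exact hg k

theorem m_eq_of_isConj {p q : USofic n ω} (h : IsConj p q) : m p = m q := by
  obtain ⟨g, rfl⟩ := isConj_iff.mp h
  obtain ⟨p, rfl⟩ := QuotientGroup.mk_surjective p
  obtain ⟨g, rfl⟩ := QuotientGroup.mk_surjective g
  refine tendsto_nhds_unique (tendsto_permM p) ?_
  exact (tendsto_permM (g * p * g⁻¹)).congr fun k => by
    rw [← permM_conj (g k) (p k)]; rfl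

theorem numCyc_eq_of_isConj {p q : USofic n ω} (h : IsConj p q) : numCyc p = numCyc q := by
  obtain ⟨g, rfl⟩ := isConj_iff.mp h
  obtain ⟨p, rfl⟩ := QuotientGroup.mk_surjective p
  obtain ⟨g, rfl⟩ := QuotientGroup.mk_surjective g
  refine tendsto_nhds_unique (tendsto_permN p) ?_
  exact (tendsto_permN (g * p * g⁻¹)).congr fun k => by
    rw [← permN_conj (g k) (p k)]; rfl

theorem m_add_numCyc_mul_le (x y : USofic n ω) :
    m (x * y) + numCyc (x * y) ≤ m x + numCyc x + (m y + numCyc y) := by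
  obtain ⟨x, rfl⟩ := QuotientGroup.mk_surjective x
  obtain ⟨y, rfl⟩ := QuotientGroup.mk_surjective y
  refine le_of_tendsto_of_tendsto' ((tendsto_permM (x * y)).add (tendsto_permN (x * y)))
    (((tendsto_permM x).add (tendsto_permN x)).add ((tendsto_permM y).add (tendsto_permN y)))
    fun k => ?_
  simp only [← add_div]
  refine div_le_div_of_nonneg_right ?_ (Nat.cast_nonneg _)
  exact_mod_cast permM_add_permN_mul_le (x k) (y k)

theorem m_add_numCyc_mul_le' (x y : USofic n ω) :
    m x + numCyc (x * y) ≤ m (x * y) + m y + numCyc x := by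
  obtain ⟨x, rfl⟩ := QuotientGroup.mk_surjective x
  obtain ⟨y, rfl⟩ := QuotientGroup.mk_surjective y
  refine le_of_tendsto_of_tendsto' ((tendsto_permM x).add (tendsto_permN (x * y)))
    (((tendsto_permM (x * y)).add (tendsto_permM y)).add (tendsto_permN x))
    fun k => ?_
  simp only [← add_div]
  refine div_le_div_of_nonneg_right ?_ (Nat.cast_nonneg _)
  exact_mod_cast permM_add_permN_mul_le' (x k) (y k)

/-- Truncated subtraction is the positive part, so an inequality between limits holds between the
sequences up to a negligible defect. -/
theorem tendsto_tsub_div {u v : ℕ → ℕ} {a b : ℝ}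
    (hu : Tendsto (fun k => (u k : ℝ) / n k) ω (𝓝 a))
    (hv : Tendsto (fun k => (v k : ℝ) / n k) ω (𝓝 b)) (hab : a ≤ b) :
    Tendsto (fun k => ((u k - v k : ℕ) : ℝ) / n k) ω (𝓝 0) := by
  have h := (hu.sub hv).max (tendsto_const_nhds (x := (0 : ℝ)))
  rw [max_eq_right (sub_nonpos.mpr hab)] at h
  refine squeeze_zero (fun k => by positivity) (fun k => ?_) h
  rcases le_total (u k) (v k) with hle | hle
  · rw [Nat.sub_eq_zero_of_le hle]
    simp
  · rw [Nat.cast_sub hle, sub_div]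
    exact le_max_left _ _

theorem tendsto_const_div (hlim : Tendsto n atTop atTop) (hω : ∀ k : ℕ, ω ≠ pure k) (C : ℝ) :
    Tendsto (fun k => C / n k) ω (𝓝 0) := by
  have hle : (ω : Filter ℕ) ≤ atTop := by
    rw [← Nat.cofinite_eq_atTop]
    rcases ω.le_cofinite_or_eq_pure with h | ⟨a, h⟩
    · exact h
    · exact absurd h (hω a)
  exact (tendsto_const_nhds.div_atTop (tendsto_natCast_atTop_atTop.comp hlim)).mono_left hle

theorem mem_conjugatesOf_mul_conjugatesOf_iff (n : ℕ → ℕ) (hn : ∀ k, 0 < n k) (hlim : Tendsto n atTop atTop)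
    (ω : Ultrafilter ℕ) (hω : ∀ k : ℕ, ω ≠ pure k)
    (p q₁ q₂ : USofic n ω)
    (hq₁ : q₁ ∈ cycOneInf n ω) (hq₂ : q₂ ∈ cycOneInf n ω)
    (hle : cycInf q₂ ≤ cycInf q₁) :
    p ∈ conjugatesOf q₁ * conjugatesOf q₂ ↔
      m p + numCyc p ≤ cycInf q₁ + cycInf q₂ ∧
      m p - numCyc p ≥ cycInf q₁ - cycInf q₂ := by
  have hn₁ := numCyc_eq_zero hn hq₁
  have hn₂ := numCyc_eq_zero hn hq₂
  rw [cycInf_eq_m hn hq₁, cycInf_eq_m hn hq₂] at *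
  constructor
  · rintro ⟨x, hx, y, hy, rfl⟩
    have hx' : IsConj q₁ x := hx
    have hy' : IsConj q₂ y := hy
    have h1 := m_add_numCyc_mul_le x y
    have h2 := m_add_numCyc_mul_le' x y
    rw [← m_eq_of_isConj hx', ← numCyc_eq_of_isConj hx', ← m_eq_of_isConj hy'] at h1 h2
    rw [← numCyc_eq_of_isConj hy'] at h1
    constructor <;> linarith
  · rintro ⟨h1, h2⟩
    obtain ⟨p, rfl⟩ := QuotientGroup.mk_surjective p
    obtain ⟨q₁, rfl⟩ := QuotientGroup.mk_surjective q₁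
    obtain ⟨q₂, rfl⟩ := QuotientGroup.mk_surjective q₂
    have hM := tendsto_permM (ω := ω) p
    have hP := tendsto_permN (ω := ω) p
    have ha := tendsto_permM (ω := ω) q₁
    have hb := tendsto_permM (ω := ω) q₂
    have hadd : ∀ {u v : ℕ → ℕ} {s t : ℝ}, Tendsto (fun k => (u k : ℝ) / n k) ω (𝓝 s) →
        Tendsto (fun k => (v k : ℝ) / n k) ω (𝓝 t) →
        Tendsto (fun k => ((u k + v k : ℕ) : ℝ) / n k) ω (𝓝 (s + t)) := fun hu hv =>
      (hu.add hv).congr fun k => by rw [Nat.cast_add, add_div]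
    -- `E k` is the total defect of the three inequalities at index `k`. The finite factorization
    -- thus applies at every `k`, while E k / n k tends to 0.
    obtain ⟨E, hE⟩ : ∃ E : ℕ → ℕ, ∀ k, E k = (permM (q₂ k) - permM (q₁ k))
        + ((permM (p k) + permN (p k)) - (permM (q₁ k) + permM (q₂ k)))
        + ((permM (q₁ k) + permN (p k)) - (permM (q₂ k) + permM (p k))) := ⟨_, fun _ => rfl⟩
    have hElim : Tendsto (fun k => (E k : ℝ) / n k) ω (𝓝 0) := by
      have h := hadd (hadd (tendsto_tsub_div hb ha hle)
        (tendsto_tsub_div (hadd hM hP) (hadd ha hb) h1))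
        (tendsto_tsub_div (hadd ha hP) (hadd hb hM) (by linarith))
      simp only [add_zero] at h
      exact h.congr fun k => by rw [hE k]
    have hfact := fun k => exists_mul_cycOn (hn k) (p k) (a := permM (q₁ k))
      (b := permM (q₂ k)) (E := E k) (permM_le _) (by have := hE k; omega)
      (by have := hE k; omega) (by have := hE k; omega)
    choose X Y A B hXY hX hY hA hB hA1 hA2 hB1 hB2 using hfact
    -- Both truncated length differences are at most 10E + 10, and `CycOn.exists_conj_near` doubles
    -- their sum: 2 · 2 · (10E + 10) = 40E + 40.
    have herr : ∀ q : ∀ k, S (n k), numCyc (QuotientGroup.mk q : USofic n ω) = 0 →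
        Tendsto (fun k => ((40 * E k + 40 + permN (q k) : ℕ) : ℝ) / n k) ω (𝓝 0) := by
      intro q hq
      have h := ((hElim.const_mul 40).add (tendsto_const_div hlim hω 40)).add
        (tendsto_permN (ω := ω) q)
      rw [hq, mul_zero, add_zero, add_zero] at h
      refine h.congr fun k => ?_
      push_cast
      ring
    refine ⟨QuotientGroup.mk X, ?_, QuotientGroup.mk Y, ?_, ?_⟩
    · refine (isConj_mk_of_tendsto (fun k => ?_) (herr q₁ hn₁)).symm
      obtain ⟨g, hg⟩ := (hX k).exists_conj_near (hA k) (q₁ k)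
      exact ⟨g, by have := hA1 k; have := hA2 k; omega⟩
    · refine (isConj_mk_of_tendsto (fun k => ?_) (herr q₂ hn₂)).symm
      obtain ⟨g, hg⟩ := (hY k).exists_conj_near (hB k) (q₂ k)
      exact ⟨g, by have := hB1 k; have := hB2 k; omega⟩
    · exact congrArg QuotientGroup.mk (funext hXY)

end SoficGroup

end

theorem mainTheorem3 (n : ℕ → ℕ) (hn : ∀ k, 0 < n k) (hlim : Tendsto n atTop atTop)
    (ω : Ultrafilter ℕ) (hω : ∀ k : ℕ, ω ≠ pure k)
    (p q₁ q₂ : SoficGroup.USofic n ω)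
    (hq₁ : q₁ ∈ SoficGroup.cycOneInf n ω) (hq₂ : q₂ ∈ SoficGroup.cycOneInf n ω)
    (hle : SoficGroup.cycInf q₂ ≤ SoficGroup.cycInf q₁) (hpos : 0 < SoficGroup.cycInf q₂) :
    p ∈ conjugatesOf q₁ * conjugatesOf q₂ ↔
      SoficGroup.m p + SoficGroup.numCyc p ≤ SoficGroup.cycInf q₁ + SoficGroup.cycInf q₂ ∧
      SoficGroup.m p - SoficGroup.numCyc p ≥ SoficGroup.cycInf q₁ - SoficGroup.cycInf q₂ := by
  exact SoficGroup.mem_conjugatesOf_mul_conjugatesOf_iff n hn hlim ω hω p q₁ q₂ hq₁ hq₂ hle
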